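/- Let $G$ be a compact Hausdorff topological group with normalized (regular) Haar measure, let $K\subseteq G$ be a closed subgroup, let $V=G/K=\{gK\mid g\in G\}$ be the left coset space, and let $\mu$ be the Borel probability measure on $V$ that is the image of the Haar measure under $g\mapsto gK$. The group $G$ acts on $L^2(V,\mu)$ (complex-valued functions) by $(g\cdot f)(x)=f(g^{-1}x)$. Let $d$ be the smallest degree (dimension) of a nontrivial irreducible finite-dimensional representation of $G$ which occurs as a subrepresentation of $L^2(V,\mu)$; if there is none, put $d=\infty$ and $1/\sqrt d=0$. Let $H\in L^2(V\times V,\mu\times\mu)$ be a complex Hilbert–Schmidt kernel which is self-adjoint, i.e. $H(x,y)=\overline{H(y,x)}$ for almost all $(x,y)$, which is $G$-invariant, i.e. for every $g\in G$ one has $H(gx,gy)=H(x,y)$ for almost all $(x,y)$, and which satisfies $\|H\|_2=\bigl(\int_{V\times V}|H|^2\,d(\mu\times\mu)\bigr)^{1/2}\le 1$. Let $p$ be the constant function on $V\times V$ with value $\int_{V\times V}H\,d(\mu\times\mu)$. Then $$\|H-p\|_\square\le\frac1{\sqrt d},$$ where for $M\in L^2(V\times V,\mu\times\mu)$ the cut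 norm is $$\|M\|_\square=\sup_{f,g}\ \Bigl|\int_V\overline{f(x)}\int_V M(x,y)\,g(y)\,d\mu(y)\,d\mu(x)\Bigr|,$$ the supremum being over all measurable $f,g:V\to\mathbb C$ with $\|f\|_\infty\le1$ and $\|g\|_\infty\le1$. -/

import Mathlib

open MeasureTheory
open scoped ENNReal ComplexConjugate

noncomputable section

/-- The measure on the left coset space `G ⧸ K` induced by the measure `μ` on `G`. -/
def cosetMeasure {G : Type*} [Group G] [MeasurableSpace G] (μ : Measure G) (K : Subgroup G)
    [MeasurableSpace (G ⧸ K)] : Measure (G ⧸ K) :=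
  μ.map (fun g : G => (g : G ⧸ K))

/-- The induced measure is invariant under left translation by `G`. -/
instance cosetMeasure_smulInvariant {G : Type*} [Group G] [TopologicalSpace G]
    [IsTopologicalGroup G] [MeasurableSpace G] [BorelSpace G]
    (μ : Measure G) [μ.IsMulLeftInvariant] (K : Subgroup G)
    [MeasurableSpace (G ⧸ K)] [BorelSpace (G ⧸ K)] :
    SMulInvariantMeasure G (G ⧸ K) (cosetMeasure μ K) where
  measure_preimage_smul g s hs := by
    have hmk : Measurable (fun g : G => (g : G ⧸ K)) :=
      (QuotientGroup.continuous_mk (N := K)).measurable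
    have hg : Measurable (fun x : G ⧸ K => g • x) := (continuous_const_smul g).measurable
    unfold cosetMeasure
    rw [Measure.map_apply hmk (hg hs), Measure.map_apply hmk hs]
    exact measure_preimage_mul μ g ((fun g : G => (g : G ⧸ K)) ⁻¹' s)

/-- The representation of `G` on `L²(V, ν)` induced by a measure preserving action of `G` on `V`:
`(g · f)(x) = f (g⁻¹ • x)`. -/
def leftTranslation (G : Type*) [Group G] {V : Type*} [MeasurableSpace V] [MulAction G V]
    [MeasurableConstSMul G V] (ν : Measure V) [SMulInvariantMeasure G V ν] :
    Representation ℂ G (Lp ℂ 2 ν) where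
  toFun g := Lp.compMeasurePreservingₗ ℂ (fun x : V => g⁻¹ • x) (measurePreserving_smul g⁻¹ ν)
  map_one' := by
    ext1 f
    apply Lp.ext
    refine (Lp.coeFn_compMeasurePreserving f (measurePreserving_smul (1 : G)⁻¹ ν)).trans ?_
    exact Filter.Eventually.of_forall fun x => by simp
  map_mul' g h := by
    ext1 f
    apply Lp.ext
    refine (Lp.coeFn_compMeasurePreserving f (measurePreserving_smul (g * h)⁻¹ ν)).trans ?_
    have h1 := Lp.coeFn_compMeasurePreserving
      (Lp.compMeasurePreserving _ (measurePreserving_smul h⁻¹ ν) f) (measurePreserving_smul g⁻¹ ν)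
    have h2 := (measurePreserving_smul g⁻¹ ν).quasiMeasurePreserving.ae_eq_comp
      (Lp.coeFn_compMeasurePreserving f (measurePreserving_smul h⁻¹ ν))
    refine Filter.EventuallyEq.trans ?_ (h1.trans h2).symm
    exact Filter.Eventually.of_forall fun x => by simp [mul_smul]

/-- The smallest degree (dimension) of a nontrivial finite-dimensional irreducible representation
of `G` that occurs in `ρ`, that is, as a subrepresentation of `ρ`; it is `⊤` if there is none. -/
def minNontrivialDegree {G W : Type*} [Group G] [AddCommGroup W] [Module ℂ W]
    (ρ : Representation ℂ G W) : ℕ∞ :=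
  ⨅ (U : Subrepresentation ρ) (_ : FiniteDimensional ℂ U.toSubmodule)
    (_ : U.toRepresentation.IsIrreducible) (_ : ¬ U.toRepresentation.IsTrivial),
    (Module.finrank ℂ U.toSubmodule : ℕ∞)

/-- The action of a kernel operator on functions: `(M f)(x) = ∫ M(x, y) f(y) dy`. -/
def kernelApply {V : Type*} [MeasurableSpace V] (ν : Measure V) (M : V × V → ℂ) (f : V → ℂ) :
    V → ℂ :=
  fun x => ∫ y, M (x, y) * f y ∂ν

/-- The kernel `M` is self-adjoint: `M(x, y)` is the conjugate of `M(y, x)` almost everywhere. -/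
def IsSelfAdjointKernel {V : Type*} [MeasurableSpace V] (ν : Measure V) (M : V × V → ℂ) : Prop :=
  ∀ᵐ z ∂(ν.prod ν), M z = conj (M z.swap)

/-- The kernel `M` is invariant under every element of `G` (as an element of `L²(V × V)`, that
is, up to a null set that may depend on the group element). -/
def IsInvariantKernel (G : Type*) [Group G] {V : Type*} [MeasurableSpace V] [MulAction G V]
    (ν : Measure V) (M : V × V → ℂ) : Prop :=
  ∀ g : G, ∀ᵐ z ∂(ν.prod ν), M (g • z.1, g • z.2) = M z

/-- The cut norm `‖M‖_□ = sup |f^* M g|` over all measurable `f`, `g` on `V` with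
`‖f‖_∞, ‖g‖_∞ ≤ 1`, where `f^* M g = ∫ conj (f x) (M g)(x) dx`. -/
def cutNorm {V : Type*} [MeasurableSpace V] (ν : Measure V) (M : V × V → ℂ) : ℝ≥0∞ :=
  ⨆ (f : V → ℂ) (g : V → ℂ)
    (_ : AEStronglyMeasurable f ν ∧ eLpNorm f ∞ ν ≤ 1)
    (_ : AEStronglyMeasurable g ν ∧ eLpNorm g ∞ ν ≤ 1),
    ‖∫ x, conj (f x) * kernelApply ν M g x ∂ν‖ₑ

end

/-! ### Hilbert–Schmidt integral operators -/

section KernelOperator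

variable {V : Type*} [MeasurableSpace V] {ν : Measure V} {M : V × V → ℂ}

/-! Put `M = H - p` and let `T` be its integral operator on L². Functions bounded by 1 on a
probability space lie in the unit ball of L², so the cut norm of `M` is at most `‖T‖`
(`cutNorm_le_enorm_kernelOp`), and it remains to prove `‖T‖² d ≤ 1` when `T ≠ 0`.

Removing the mean is an orthogonal projection, so `T` has Hilbert–Schmidt norm at most 1. It is
therefore compact, and being symmetric it has an eigenvalue `c` with `|c| = ‖T‖`. The eigenspace is
finite-dimensional, and it is `G`-stable because `T` commutes with `G` (`leftTranslation_kernelOp`).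
Invariant vectors of L² are constants, and `T` kills them since `M` has mean zero
(`kernelOp_eq_zero_of_leftTranslation_eq`). Hence the eigenspace contains a nontrivial irreducible
`U`, with `dim U ≥ d`. On `U` the operator is the scalar `c`, so an orthonormal basis of `U`
contributes `dim U · ‖T‖²` to the squared Hilbert–Schmidt norm (`sum_norm_kernelOp_sq_le`). This
gives `d ‖T‖² ≤ 1`: multiplicity forces the eigenvalue to be small. -/

lemma eLpNorm_two_sq_eq_lintegral {X : Type*} [MeasurableSpace X] (m : Measure X) (f : X → ℂ) :
    eLpNorm f 2 m ^ 2 = ∫⁻ x, ‖f x‖ₑ ^ 2 ∂m := by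
  simpa using! eLpNorm_nnreal_pow_eq_lintegral (f := f) (μ := m) (p := 2) (by norm_num)

lemma kernelApply_congr_ae {f g : V → ℂ} (h : f =ᵐ[ν] g) :
    kernelApply ν M f = kernelApply ν M g := by
  ext x
  exact integral_congr_ae (h.mono fun y hy => by simp [hy])

/-- The row is conjugated because `inner` is conjugate-linear in its first argument. Linearity,
Cauchy–Schwarz and Bessel for the kernel then come row by row from the Hilbert space. -/
lemma kernelApply_eq_inner {x : V} (hx : MemLp (fun y => M (x, y)) 2 ν) (f : Lp ℂ 2 ν) :
    kernelApply ν M f x = inner ℂ (hx.star.toLp _) f := by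
  rw [L2.inner_def]
  refine integral_congr_ae ?_
  filter_upwards [hx.star.coeFn_toLp] with y hy
  rw [hy]
  simp [mul_comm]

variable [IsProbabilityMeasure ν]

/-- The squared norms of the rows of a square integrable kernel integrate to its squared norm. -/
lemma lintegral_eLpNorm_row_sq (hM : MemLp M 2 (ν.prod ν)) :
    ∫⁻ x, eLpNorm (fun y => M (x, y)) 2 ν ^ 2 ∂ν = eLpNorm M 2 (ν.prod ν) ^ 2 := by
  rw [eLpNorm_two_sq_eq_lintegral, lintegral_prod _ (hM.1.enorm.pow_const 2)]
  simp only [eLpNorm_two_sq_eq_lintegral]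

/-- Almost every row of a square integrable kernel is square integrable. -/
lemma ae_memLp_row (hM : MemLp M 2 (ν.prod ν)) : ∀ᵐ x ∂ν, MemLp (fun y => M (x, y)) 2 ν := by
  have h : ∀ᵐ x ∂ν, eLpNorm (fun y => M (x, y)) 2 ν ^ 2 < ∞ := by
    simp only [eLpNorm_two_sq_eq_lintegral]
    refine ae_lt_top' (hM.1.enorm.pow_const 2).lintegral_prod_right' ?_
    simp only [← eLpNorm_two_sq_eq_lintegral]
    rw [lintegral_eLpNorm_row_sq hM]
    exact ENNReal.pow_ne_top hM.2.ne
  filter_upwards [hM.1.prodMk_left, h] with x hx hx'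
  exact ⟨hx, lt_top_iff_ne_top.2 fun h0 => by simp [h0] at hx'⟩

/-- Bessel's inequality for almost every row of a square integrable kernel. -/
lemma ae_sum_enorm_kernelApply_sq_le (hM : MemLp M 2 (ν.prod ν)) {ι : Type*} {e : ι → Lp ℂ 2 ν}
    (he : Orthonormal ℂ e) (s : Finset ι) :
    ∀ᵐ x ∂ν, ∑ i ∈ s, ‖kernelApply ν M (e i) x‖ₑ ^ 2 ≤ eLpNorm (fun y => M (x, y)) 2 ν ^ 2 := by
  filter_upwards [ae_memLp_row hM] with x hx
  have h := he.sum_inner_products_le (hx.star.toLp _) (s := s)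
  have h2 : eLpNorm (fun y => M (x, y)) 2 ν = ‖hx.star.toLp _‖ₑ := by
    rw [Lp.enorm_toLp]
    exact (eLpNorm_star ..).symm
  have h3 (i : ι) : ‖kernelApply ν M (e i) x‖ₑ ^ 2
      = ENNReal.ofReal (‖inner ℂ (e i) (hx.star.toLp _)‖ ^ 2) := by
    rw [kernelApply_eq_inner hx, norm_inner_symm, ENNReal.ofReal_pow (norm_nonneg _),
      ofReal_norm]
  rw [h2, ← ofReal_norm, ← ENNReal.ofReal_pow (norm_nonneg _)]
  simp only [h3]
  rw [← ENNReal.ofReal_sum_of_nonneg fun i _ => by positivity]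
  exact ENNReal.ofReal_le_ofReal h

lemma aestronglyMeasurable_kernelApply (hM : MemLp M 2 (ν.prod ν)) (f : Lp ℂ 2 ν) :
    AEStronglyMeasurable (kernelApply ν M f) ν :=
  AEStronglyMeasurable.integral_prod_right' (f := fun z : V × V => M z * f z.2)
    (hM.1.mul (Lp.aestronglyMeasurable f).comp_snd)

lemma eLpNorm_kernelApply_le (hM : MemLp M 2 (ν.prod ν)) (f : Lp ℂ 2 ν) :
    eLpNorm (kernelApply ν M f) 2 ν ≤ eLpNorm M 2 (ν.prod ν) * ‖f‖ₑ := by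
  rw [← ENNReal.pow_le_pow_left_iff two_ne_zero, mul_pow, ← lintegral_eLpNorm_row_sq hM,
    eLpNorm_two_sq_eq_lintegral, ← lintegral_mul_const' _ _ (by simp)]
  refine lintegral_mono_ae ?_
  filter_upwards [ae_memLp_row hM] with x hx
  rw [← mul_pow, kernelApply_eq_inner hx]
  gcongr
  have h2 : eLpNorm (fun y => M (x, y)) 2 ν = ‖hx.star.toLp _‖ₑ := by
    rw [Lp.enorm_toLp]
    exact (eLpNorm_star ..).symm
  rw [h2, ← ofReal_norm, ← ofReal_norm, ← ofReal_norm,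
    ← ENNReal.ofReal_mul (norm_nonneg _)]
  exact ENNReal.ofReal_le_ofReal (norm_inner_le_norm _ _)

lemma memLp_kernelApply (hM : MemLp M 2 (ν.prod ν)) (f : Lp ℂ 2 ν) :
    MemLp (kernelApply ν M f) 2 ν :=
  ⟨aestronglyMeasurable_kernelApply hM f, (eLpNorm_kernelApply_le hM f).trans_lt
    (ENNReal.mul_lt_top hM.2 (by simp))⟩

/-- The integral operator on `L²` with a square integrable kernel. -/
noncomputable def kernelOp (hM : MemLp M 2 (ν.prod ν)) : Lp ℂ 2 ν →L[ℂ] Lp ℂ 2 ν :=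
  LinearMap.mkContinuous
    { toFun := fun f => (memLp_kernelApply hM f).toLp _
      map_add' := fun f g => by
        rw [← MemLp.toLp_add, MemLp.toLp_eq_toLp_iff]
        filter_upwards [ae_memLp_row hM] with x hx
        simp only [Pi.add_apply]
        rw [kernelApply_eq_inner hx, kernelApply_eq_inner hx, kernelApply_eq_inner hx,
          inner_add_right]
      map_smul' := fun c f => by
        rw [RingHom.id_apply, ← MemLp.toLp_const_smul, MemLp.toLp_eq_toLp_iff]
        filter_upwards [ae_memLp_row hM] with x hx
        simp only [Pi.smul_apply]
        rw [kernelApply_eq_inner hx, kernelApply_eq_inner hx, inner_smul_right, smul_eq_mul] }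
    (eLpNorm M 2 (ν.prod ν)).toReal fun f => by
      simp only [LinearMap.coe_mk, AddHom.coe_mk, Lp.norm_toLp]
      rw [← toReal_enorm, ← ENNReal.toReal_mul]
      exact ENNReal.toReal_mono (ENNReal.mul_ne_top hM.2.ne (by simp))
        (eLpNorm_kernelApply_le hM f)

lemma kernelOp_apply (hM : MemLp M 2 (ν.prod ν)) (f : Lp ℂ 2 ν) :
    kernelOp hM f = (memLp_kernelApply hM f).toLp _ := rfl

lemma coeFn_kernelOp (hM : MemLp M 2 (ν.prod ν)) (f : Lp ℂ 2 ν) :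
    kernelOp hM f =ᵐ[ν] kernelApply ν M f :=
  MemLp.coeFn_toLp (memLp_kernelApply hM f)

/-- Orthonormal families detect at most the Hilbert–Schmidt norm of an integral operator. -/
lemma sum_norm_kernelOp_sq_le (hM : MemLp M 2 (ν.prod ν)) {ι : Type*} {e : ι → Lp ℂ 2 ν}
    (he : Orthonormal ℂ e) (s : Finset ι) :
    ∑ i ∈ s, ‖kernelOp hM (e i)‖ ^ 2 ≤ (eLpNorm M 2 (ν.prod ν)).toReal ^ 2 := by
  have h : ∑ i ∈ s, eLpNorm (kernelApply ν M (e i)) 2 ν ^ 2 ≤ eLpNorm M 2 (ν.prod ν) ^ 2 := by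
    simp only [eLpNorm_two_sq_eq_lintegral ν]
    rw [← lintegral_finsetSum' _ fun i _ =>
      (aestronglyMeasurable_kernelApply hM (e i)).enorm.pow_const 2, ← lintegral_eLpNorm_row_sq hM]
    exact lintegral_mono_ae (ae_sum_enorm_kernelApply_sq_le hM he s)
  have h2 := ENNReal.toReal_mono (ENNReal.pow_ne_top hM.2.ne) h
  rw [ENNReal.toReal_sum fun i _ => ENNReal.pow_ne_top (memLp_kernelApply hM _).2.ne] at h2
  simpa [kernelOp_apply, Lp.norm_toLp] using h2

end KernelOperator

/-- A bounded operator whose squared norms along an orthonormal basis have bounded partial sums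
is compact. -/
lemma isCompactOperator_of_sum_norm_sq_le {E : Type*} [NormedAddCommGroup E]
    [InnerProductSpace ℂ E] [CompleteSpace E] (T : E →L[ℂ] E) {ι : Type*}
    (b : HilbertBasis ι ℂ E) {C : ℝ} (hC : ∀ s : Finset ι, ∑ i ∈ s, ‖T (b i)‖ ^ 2 ≤ C) :
    IsCompactOperator T := by
  have hsum : Summable fun i => ‖T (b i)‖ ^ 2 :=
    summable_of_sum_le (fun i => by positivity) hC
  -- Rank-one pieces of `T`: `A i` sends `x` to `⟨b i, x⟩ T (b i)`.
  let A (i : ι) : E →L[ℂ] E := (innerSL ℂ (b i)).smulRight (T (b i))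
  have hA (i : ι) : IsCompactOperator (A i) :=
    (isCompactOperator_of_locallyCompactSpace_rng
      (R₂ := ℂ) (ContinuousLinearMap.toSpanSingleton ℂ (T (b i)))).comp_clm (innerSL ℂ (b i))
  have hF (s : Finset ι) : IsCompactOperator (∑ i ∈ s, A i : E →L[ℂ] E) :=
    Submodule.sum_mem (compactOperator (RingHom.id ℂ) E E) fun i _ => hA i
  -- Cauchy–Schwarz and Bessel. The bound holds for every finite set, so it controls the tails of
  -- the series in operator norm.
  have hbound (t : Finset ι) (x : E) :
      ‖(∑ i ∈ t, A i) x‖ ≤ √(∑ i ∈ t, ‖T (b i)‖ ^ 2) * ‖x‖ := by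
    rw [sum_apply]
    calc ‖∑ i ∈ t, A i x‖ ≤ ∑ i ∈ t, ‖T (b i)‖ * ‖inner ℂ (b i) x‖ := by
          refine (norm_sum_le _ _).trans (Finset.sum_le_sum fun i _ => ?_)
          simp [A, norm_smul, mul_comm]
      _ ≤ √(∑ i ∈ t, ‖T (b i)‖ ^ 2) * √(∑ i ∈ t, ‖inner ℂ (b i) x‖ ^ 2) :=
          Real.sum_mul_le_sqrt_mul_sqrt _ _ _
      _ ≤ √(∑ i ∈ t, ‖T (b i)‖ ^ 2) * ‖x‖ := by
          gcongr
          exact Real.sqrt_le_left (norm_nonneg x) |>.2 (b.orthonormal.sum_inner_products_le x)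
  have hsumA : Summable A := by
    rw [summable_iff_vanishing_norm] at hsum ⊢
    intro ε hε
    obtain ⟨s, hs⟩ := hsum ((ε / 2) ^ 2) (by positivity)
    refine ⟨s, fun t ht => ?_⟩
    refine (ContinuousLinearMap.opNorm_le_bound _ (by positivity) (hbound t)).trans_lt ?_
    refine ((Real.sqrt_lt' (by positivity)).2 ?_).trans (half_lt_self hε)
    exact (le_abs_self _).trans_lt (hs t ht)
  obtain ⟨L, hL⟩ := hsumA
  have hLT : L = T := by
    ext x
    have h1 : HasSum (fun i => A i x) (L x) :=
      hL.mapL (ContinuousLinearMap.apply ℂ E x)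
    have h2 : HasSum (fun i => A i x) (T x) := by
      simpa [A, b.repr_apply_apply] using (b.hasSum_repr x).mapL T
    exact h1.unique h2
  subst hLT
  exact isCompactOperator_of_tendsto hL (Filter.Eventually.of_forall hF)

/-! ### Compactness and symmetry of the integral operator -/

section KernelOperator

variable {V : Type*} [MeasurableSpace V] {ν : Measure V} {M : V × V → ℂ}

lemma integrable_kernel_mul [SFinite ν] (hM : MemLp M 2 (ν.prod ν)) (f h : Lp ℂ 2 ν) :
    Integrable (fun z : V × V => conj (h z.1) * (M z * f z.2)) (ν.prod ν) := by
  have h1 : MemLp (fun z : V × V => conj (h z.1) * f z.2) 2 (ν.prod ν) := by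
    have hm : AEStronglyMeasurable (fun z : V × V => conj (h z.1) * f z.2) (ν.prod ν) :=
      (Lp.aestronglyMeasurable h).star.comp_fst.mul (Lp.aestronglyMeasurable f).comp_snd
    rw [memLp_two_iff_integrable_sq_norm hm]
    have hf := (memLp_two_iff_integrable_sq_norm (Lp.aestronglyMeasurable f)).1 (Lp.memLp f)
    have hh := (memLp_two_iff_integrable_sq_norm (Lp.aestronglyMeasurable h)).1 (Lp.memLp h)
    simpa [mul_pow] using hh.mul_prod hf
  refine (hM.integrable_mul h1).congr (Filter.Eventually.of_forall fun z => ?_)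
  simp only [Pi.mul_apply]
  ring

variable [IsProbabilityMeasure ν]

lemma isCompactOperator_kernelOp (hM : MemLp M 2 (ν.prod ν)) : IsCompactOperator (kernelOp hM) := by
  obtain ⟨w, b, -⟩ := exists_hilbertBasis ℂ (Lp ℂ 2 ν)
  exact isCompactOperator_of_sum_norm_sq_le _ b fun s => sum_norm_kernelOp_sq_le hM b.orthonormal s

lemma inner_kernelOp (hM : MemLp M 2 (ν.prod ν)) (f h : Lp ℂ 2 ν) :
    inner ℂ h (kernelOp hM f) = ∫ z, conj (h z.1) * (M z * f z.2) ∂(ν.prod ν) := by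
  rw [integral_prod _ (integrable_kernel_mul hM f h), L2.inner_def]
  refine integral_congr_ae ?_
  filter_upwards [coeFn_kernelOp hM f] with x hx
  rw [hx, integral_const_mul]
  simp [kernelApply, mul_comm]

lemma isSymmetric_kernelOp (hM : MemLp M 2 (ν.prod ν)) (hself : IsSelfAdjointKernel ν M) :
    (kernelOp hM : Lp ℂ 2 ν →ₗ[ℂ] Lp ℂ 2 ν).IsSymmetric := by
  intro f h
  simp only [ContinuousLinearMap.coe_coe]
  rw [← inner_conj_symm, inner_kernelOp, inner_kernelOp, ← integral_conj, ← integral_prod_swap]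
  refine integral_congr_ae ?_
  filter_upwards [hself] with z hz
  rw [hz]
  simp
  ring

end KernelOperator

/-! ### Commutation with the group action -/

section Equivariance

variable {G V : Type*} [Group G] [MeasurableSpace V] [MulAction G V] [MeasurableConstSMul G V]
  {ν : Measure V} [SMulInvariantMeasure G V ν]

lemma coeFn_leftTranslation (g : G) (f : Lp ℂ 2 ν) :
    leftTranslation G ν g f =ᵐ[ν] fun x => f (g⁻¹ • x) :=
  Lp.coeFn_compMeasurePreserving f (measurePreserving_smul g⁻¹ ν)

variable [IsProbabilityMeasure ν] {M : V × V → ℂ}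

/-- The integral operator of an invariant kernel commutes with the group action. -/
lemma leftTranslation_kernelOp (hM : MemLp M 2 (ν.prod ν)) (hinv : IsInvariantKernel G ν M) (g : G)
    (f : Lp ℂ 2 ν) :
    leftTranslation G ν g (kernelOp hM f) = kernelOp hM (leftTranslation G ν g f) := by
  have hq := (measurePreserving_smul g⁻¹ ν).quasiMeasurePreserving
  apply Lp.ext
  -- Fubini turns invariance under the fixed `g` into a statement about almost every row. Pulled
  -- back along `g⁻¹`, it compares row `x` with row `g⁻¹ • x`.
  filter_upwards [coeFn_leftTranslation g (kernelOp hM f),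
    coeFn_kernelOp hM (leftTranslation G ν g f), hq.ae_eq_comp (coeFn_kernelOp hM f),
    hq.ae (Measure.ae_ae_of_ae_prod (hinv g))] with x h1 h2 h3 h4
  simp only [Function.comp_apply] at h3
  rw [h1, h2, h3, kernelApply_congr_ae (coeFn_leftTranslation g f)]
  simp only [kernelApply]
  rw [← (measurePreserving_smul g ν).integral_comp (MeasurableEquiv.smul g).measurableEmbedding
    (fun y => M (x, y) * f (g⁻¹ • y))]
  refine integral_congr_ae ?_
  filter_upwards [h4] with y hy
  simp only [smul_inv_smul] at hy
  simp [hy]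

end Equivariance

/-! ### Translation-invariant functions on a compact group -/

section Invariants

variable {G : Type*} [Group G] [TopologicalSpace G] [IsTopologicalGroup G]
    [CompactSpace G] [MeasurableSpace G] [BorelSpace G]
    {μ : Measure G} [μ.IsMulLeftInvariant] [μ.Regular] [IsProbabilityMeasure μ]

/-- Invariance of `F` moves the translation onto `φ`, and averaging over `g` replaces `φ` by a
constant. The null set in the hypothesis depends on `g`, so the argument tests against continuous
`φ` instead of comparing values of `F`. -/
lemma integral_mul_continuous_of_translation_invariant {F : G → ℂ} (hF : Integrable F μ)
    (hinv : ∀ g : G, (fun x => F (g * x)) =ᵐ[μ] F) (φ : C(G, ℂ)) :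
    ∫ x, F x * φ x ∂μ = (∫ x, F x ∂μ) * ∫ g, φ g⁻¹ ∂μ := by
  have hint : Integrable (fun z : G × G => F z.2 * φ (z.1⁻¹ * z.2)) (μ.prod μ) := by
    have hc : Continuous fun z : G × G => φ (z.1⁻¹ * z.2) := by fun_prop
    obtain ⟨C, hC⟩ := (isCompact_range (map_continuous φ)).isBounded.exists_norm_le
    -- `G` need not be second countable, so continuity on `G × G` alone does not give measurability
    -- for the product σ-algebra; compact support does.
    exact (hF.comp_snd μ).mul_bdd (c := C)
      (HasCompactSupport.stronglyMeasurable_of_prod hc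
        (HasCompactSupport.of_compactSpace _)).aestronglyMeasurable
      (Filter.Eventually.of_forall fun z => hC _ ⟨_, rfl⟩)
  have h1 (g : G) : ∫ x, F x * φ (g⁻¹ * x) ∂μ = ∫ x, F x * φ x ∂μ := by
    rw [← integral_mul_left_eq_self _ g]
    refine integral_congr_ae ?_
    filter_upwards [hinv g] with x hx
    simp [hx]
  have h2 (x : G) : ∫ g, F x * φ (g⁻¹ * x) ∂μ = F x * ∫ g, φ g⁻¹ ∂μ := by
    rw [integral_const_mul, ← integral_mul_left_eq_self _ x]
    simp
  have h3 := integral_integral_swap (f := fun g x => F x * φ (g⁻¹ * x)) hint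
  simp only [h1, h2] at h3
  rw [integral_mul_const] at h3
  simpa using h3

/-- Square integrable functions on a compact group that are invariant under translations are
constant. -/
lemma ae_eq_const_of_translation_invariant [T2Space G] {F : G → ℂ} (hF : MemLp F 2 μ)
    (hinv : ∀ g : G, (fun x => F (g * x)) =ᵐ[μ] F) :
    F =ᵐ[μ] fun _ => ∫ x, F x ∂μ := by
  have hF1 : Integrable F μ := hF.integrable one_le_two
  set c := ∫ x, F x ∂μ with hc
  have hD : MemLp (fun x => F x - c) 2 μ := hF.sub (memLp_const c)
  have key (φ : C(G, ℂ)) : ∫ x, (F x - c) * φ x ∂μ = 0 := by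
    rw [integral_mul_continuous_of_translation_invariant (F := fun x => F x - c)
      (hF1.sub (integrable_const c)) (fun g => (hinv g).mono fun x hx => by simp [hx]),
      integral_sub hF1 (integrable_const c)]
    simp [hc]
  have h0 : hD.toLp _ = 0 := by
    -- Continuous functions are dense in L², so a vector orthogonal to all of them vanishes.
    refine (ContinuousMap.toLp_denseRange ℂ μ ℂ (by simp)).eq_zero_of_inner_right ℂ fun φ => ?_
    rw [← key (star φ), L2.inner_def]
    refine integral_congr_ae ?_
    filter_upwards [hD.coeFn_toLp, ContinuousMap.coeFn_toLp (p := 2) (𝕜 := ℂ) μ φ] with x h1 h2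
    rw [h1, h2]
    simp
  have h1 := hD.coeFn_toLp
  rw [h0] at h1
  filter_upwards [h1, Lp.coeFn_zero ℂ 2 μ] with x h1 h2
  rw [h2, Pi.zero_apply] at h1
  exact sub_eq_zero.1 h1.symm

end Invariants

/-! ### Irreducible subrepresentations by minimal dimension -/

section Representation

variable {G W : Type*} [Group G] [AddCommGroup W] [Module ℂ W] {ρ : Representation ℂ G W}

/-- A nonzero subrepresentation all of whose nonzero subrepresentations have at least its
dimension is irreducible. -/
lemma Subrepresentation.isIrreducible_of_finrank_le (U : Subrepresentation ρ)
    [FiniteDimensional ℂ U.toSubmodule] (hU : U.toSubmodule ≠ ⊥)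
    (hmin : ∀ U' : Subrepresentation ρ, U'.toSubmodule ≤ U.toSubmodule → U'.toSubmodule ≠ ⊥ →
      Module.finrank ℂ U.toSubmodule ≤ Module.finrank ℂ U'.toSubmodule) :
    U.toRepresentation.IsIrreducible where
  exists_pair_ne := by
    refine ⟨⊥, ⊤, fun h => hU ?_⟩
    have h1 : (⊥ : Submodule ℂ U.toSubmodule) = ⊤ := congrArg Subrepresentation.toSubmodule h
    have h2 : Subsingleton U.toSubmodule := (Submodule.subsingleton_iff ℂ).1
      (subsingleton_of_bot_eq_top h1)
    exact (Submodule.subsingleton_iff_eq_bot).1 h2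
  eq_bot_or_eq_top := fun Y => by
    by_cases hY : Y.toSubmodule = ⊥
    · exact Or.inl (Subrepresentation.toSubmodule_injective hY)
    refine Or.inr (Subrepresentation.toSubmodule_injective ?_)
    let U' : Subrepresentation ρ :=
      { toSubmodule := Y.toSubmodule.map U.toSubmodule.subtype
        apply_mem_toSubmodule := by
          rintro g _ ⟨v, hv, rfl⟩
          exact ⟨_, Y.apply_mem_toSubmodule g hv, rfl⟩ }
    have h := hmin U' (Submodule.map_subtype_le _ _)
      (fun h => hY (Submodule.map_injective_of_injective U.toSubmodule.injective_subtype
        (h.trans (Submodule.map_bot _).symm)))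
    refine Submodule.eq_top_of_finrank_eq (le_antisymm (Submodule.finrank_le _) (h.trans ?_))
    exact Submodule.finrank_map_le _ _

/-- A nonzero finite-dimensional subrepresentation without invariant vectors contains an
irreducible nontrivial one. -/
lemma Subrepresentation.exists_isIrreducible_le (E : Subrepresentation ρ)
    [FiniteDimensional ℂ E.toSubmodule] (hE : E.toSubmodule ≠ ⊥)
    (hinv : ∀ v ∈ E.toSubmodule, (∀ g, ρ g v = v) → v = 0) :
    ∃ U : Subrepresentation ρ, U.toSubmodule ≤ E.toSubmodule ∧ U.toRepresentation.IsIrreducible ∧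
      ¬ U.toRepresentation.IsTrivial := by
  obtain ⟨U, ⟨hUE, hU⟩, hmin⟩ := exists_minimalFor_of_wellFoundedLT
    (fun U : Subrepresentation ρ => U.toSubmodule ≤ E.toSubmodule ∧ U.toSubmodule ≠ ⊥)
    (fun U => Module.finrank ℂ U.toSubmodule) ⟨E, le_rfl, hE⟩
  have := Submodule.finiteDimensional_of_le hUE
  refine ⟨U, hUE, U.isIrreducible_of_finrank_le hU fun U' hU' h0 => ?_, fun htriv => ?_⟩
  · exact (le_total _ _).elim id (hmin ⟨hU'.trans hUE, h0⟩)
  · obtain ⟨v, hv, hv0⟩ := Submodule.exists_mem_ne_zero_of_ne_bot hU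
    refine hv0 (hinv v (hUE hv) fun g => ?_)
    exact congrArg Subtype.val (U.toRepresentation.isTrivial_apply g ⟨v, hv⟩)

lemma minNontrivialDegree_le (U : Subrepresentation ρ) [h : FiniteDimensional ℂ U.toSubmodule]
    (hirr : U.toRepresentation.IsIrreducible) (hU : ¬ U.toRepresentation.IsTrivial) :
    minNontrivialDegree ρ ≤ Module.finrank ℂ U.toSubmodule :=
  iInf₂_le_of_le U h (iInf₂_le_of_le hirr hU le_rfl)

end Representation

/-! ### Invariant vectors on the coset space -/

section HomogeneousSpace

variable {G : Type*} [Group G] [TopologicalSpace G] [MeasurableSpace G]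
  [BorelSpace G] (μ : Measure G) (K : Subgroup G) [MeasurableSpace (G ⧸ K)] [BorelSpace (G ⧸ K)]

lemma measurePreserving_mk_cosetMeasure :
    MeasurePreserving (fun g : G => (g : G ⧸ K)) μ (cosetMeasure μ K) :=
  ⟨(QuotientGroup.continuous_mk (N := K)).measurable, rfl⟩

instance isProbabilityMeasure_cosetMeasure [IsProbabilityMeasure μ] :
    IsProbabilityMeasure (cosetMeasure μ K) :=
  Measure.isProbabilityMeasure_map (measurePreserving_mk_cosetMeasure μ K).measurable.aemeasurable

variable [IsTopologicalGroup G] {μ K}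

/-- The invariant vectors in `L²(G ⧸ K)` are the constants. -/
lemma ae_eq_const_of_leftTranslation_eq [CompactSpace G] [T2Space G] [μ.IsMulLeftInvariant]
    [μ.Regular] [IsProbabilityMeasure μ] (f : Lp ℂ 2 (cosetMeasure μ K))
    (hf : ∀ g : G, leftTranslation G (cosetMeasure μ K) g f = f) :
    f =ᵐ[cosetMeasure μ K] fun _ => ∫ x, f x ∂(cosetMeasure μ K) := by
  have hmk := measurePreserving_mk_cosetMeasure μ K
  have hF : MemLp (fun g : G => f (g : G ⧸ K)) 2 μ := (Lp.memLp f).comp_measurePreserving hmk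
  have hinv (g : G) : (fun x : G => f ((g * x : G) : G ⧸ K)) =ᵐ[μ] fun x : G => f (x : G ⧸ K) := by
    have h1 := coeFn_leftTranslation g⁻¹ f
    rw [hf, inv_inv] at h1
    exact (hmk.quasiMeasurePreserving.ae_eq_comp h1).symm
  have h := ae_eq_const_of_translation_invariant hF hinv
  have hint : ∫ x, f x ∂(cosetMeasure μ K) = ∫ x : G, f (x : G ⧸ K) ∂μ :=
    integral_map hmk.measurable.aemeasurable (Lp.aestronglyMeasurable f)
  rw [hint]
  -- Descending to the quotient needs the set where `f` equals the constant to be measurable, which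
  -- the strongly measurable representative ensures.
  exact (ae_map_iff hmk.measurable.aemeasurable
    ((Lp.stronglyMeasurable f).measurable (measurableSet_singleton _))).2 h

end HomogeneousSpace

/-! ### Mean, cut norm and extremal eigenvalue -/

lemma integral_kernelApply_one {V : Type*} [MeasurableSpace V] {ν : Measure V}
    [IsProbabilityMeasure ν] {M : V × V → ℂ} (hM : MemLp M 2 (ν.prod ν)) :
    ∫ x, kernelApply ν M (fun _ => 1) x ∂ν = ∫ z, M z ∂(ν.prod ν) := by
  rw [integral_prod _ (hM.integrable one_le_two)]
  simp [kernelApply]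

/-- Subtracting the mean does not increase the `L²` norm. -/
lemma eLpNorm_sub_integral_le {X : Type*} [MeasurableSpace X] {m : Measure X}
    [IsProbabilityMeasure m] {f : X → ℂ} (hf : MemLp f 2 m) :
    eLpNorm (fun x => f x - ∫ y, f y ∂m) 2 m ≤ eLpNorm f 2 m := by
  set c := ∫ y, f y ∂m with hc
  have h1 : MemLp (fun _ : X => c) 2 m := memLp_const c
  have horth : inner ℂ ((hf.sub h1).toLp _) (h1.toLp _) = 0 := by
    rw [L2.inner_def]
    have : ∫ x, inner ℂ ((hf.sub h1).toLp _ x) (h1.toLp _ x) ∂m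
        = ∫ x, c * conj (f x - c) ∂m := by
      refine integral_congr_ae ?_
      filter_upwards [(hf.sub h1).coeFn_toLp, h1.coeFn_toLp] with x hx hx'
      rw [hx, hx']
      simp
    rw [this, integral_const_mul, integral_conj,
      integral_sub (hf.integrable one_le_two) (integrable_const c)]
    simp [hc]
  have hsum : hf.toLp _ = (hf.sub h1).toLp _ + h1.toLp _ := by
    rw [← MemLp.toLp_add]
    simp
  have hnorm := norm_add_sq_eq_norm_sq_add_norm_sq_of_inner_eq_zero _ _ horth
  rw [← hsum] at hnorm
  have hle : ‖(hf.sub h1).toLp _‖ ≤ ‖hf.toLp f‖ :=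
    le_of_sq_le_sq (by nlinarith [mul_self_nonneg ‖h1.toLp (fun _ : X => c)‖]) (norm_nonneg _)
  rw [Lp.norm_toLp, Lp.norm_toLp] at hle
  exact (ENNReal.toReal_le_toReal (hf.sub h1).2.ne hf.2.ne).1 hle

/-- The cut norm of a square integrable kernel is at most the norm of its integral operator. -/
lemma cutNorm_le_enorm_kernelOp {V : Type*} [MeasurableSpace V] {ν : Measure V}
    [IsProbabilityMeasure ν] {M : V × V → ℂ} (hM : MemLp M 2 (ν.prod ν)) :
    cutNorm ν M ≤ ‖kernelOp hM‖ₑ := by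
  refine iSup₂_le fun f g => iSup₂_le fun hf hg => ?_
  have hL2 {f : V → ℂ} (hf : AEStronglyMeasurable f ν ∧ eLpNorm f ∞ ν ≤ 1) :
      ∃ h : MemLp f 2 ν, ‖h.toLp f‖ ≤ 1 := by
    have h1 : eLpNorm f 2 ν ≤ 1 :=
      (eLpNorm_le_eLpNorm_of_exponent_le le_top hf.1).trans hf.2
    have h2 : MemLp f 2 ν := ⟨hf.1, h1.trans_lt ENNReal.one_lt_top⟩
    refine ⟨h2, ?_⟩
    rw [Lp.norm_toLp]
    exact ENNReal.toReal_le_of_le_ofReal zero_le_one (by simpa using h1)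
  obtain ⟨hf2, hf1⟩ := hL2 hf
  obtain ⟨hg2, hg1⟩ := hL2 hg
  have h : ∫ x, conj (f x) * kernelApply ν M g x ∂ν
      = inner ℂ (hf2.toLp f) (kernelOp hM (hg2.toLp g)) := by
    rw [L2.inner_def]
    refine integral_congr_ae ?_
    filter_upwards [hf2.coeFn_toLp, coeFn_kernelOp hM (hg2.toLp g)] with x h1 h2
    rw [h1, h2, kernelApply_congr_ae hg2.coeFn_toLp]
    simp [mul_comm]
  rw [h, enorm_le_iff_norm_le]
  calc _ ≤ ‖hf2.toLp f‖ * (‖kernelOp hM‖ * ‖hg2.toLp g‖) :=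
        (norm_inner_le_norm _ _).trans (by gcongr; exact (kernelOp hM).le_opNorm _)
    _ ≤ 1 * (‖kernelOp hM‖ * 1) := by gcongr
    _ = ‖kernelOp hM‖ := by ring

/-- The norm of a nonzero compact symmetric operator is attained by an eigenvalue. -/
lemma exists_hasEigenvalue_norm_eq {E : Type*} [NormedAddCommGroup E] [InnerProductSpace ℂ E]
    [CompleteSpace E] {T : E →L[ℂ] E} (hT : IsCompactOperator T)
    (hsymm : (T : E →ₗ[ℂ] E).IsSymmetric) (h0 : T ≠ 0) :
    ∃ c : ℂ, ‖c‖ = ‖T‖ ∧ Module.End.HasEigenvalue (T : Module.End ℂ E) c := by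
  have : Nontrivial E := by
    by_contra h
    rw [not_nontrivial_iff_subsingleton] at h
    exact h0 (Subsingleton.elim _ _)
  obtain ⟨c, hc, hcT⟩ := spectrum.exists_nnnorm_eq_spectralRadius T
  rw [T.spectralRadius_eq_nnnorm hsymm.isSelfAdjoint, ENNReal.coe_inj] at hcT
  -- For a self-adjoint operator the spectral radius is the norm; nonzero spectral values of a
  -- compact operator are eigenvalues.
  have hnorm : ‖c‖ = ‖T‖ := congrArg NNReal.toReal hcT
  have hc0 : c ≠ 0 := by
    rw [← norm_ne_zero_iff, hnorm]
    exact norm_ne_zero_iff.2 h0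
  exact ⟨c, hnorm, (hT.hasEigenvalue_iff_mem_spectrum hc0).2 hc⟩

/-! ### The spectral gap -/

section HomogeneousSpace

variable {G : Type*} [Group G] [TopologicalSpace G] [IsTopologicalGroup G] [CompactSpace G]
  [T2Space G] [MeasurableSpace G] [BorelSpace G] {μ : Measure G} [μ.IsMulLeftInvariant]
  [μ.Regular] [IsProbabilityMeasure μ] {K : Subgroup G} [MeasurableSpace (G ⧸ K)]
  [BorelSpace (G ⧸ K)] {M : (G ⧸ K) × (G ⧸ K) → ℂ}

/-- The integral operator of an invariant kernel with mean zero annihilates the invariant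
vectors. -/
lemma kernelOp_eq_zero_of_leftTranslation_eq
    (hM : MemLp M 2 ((cosetMeasure μ K).prod (cosetMeasure μ K)))
    (hinv : IsInvariantKernel G (cosetMeasure μ K) M)
    (hmean : ∫ z, M z ∂((cosetMeasure μ K).prod (cosetMeasure μ K)) = 0)
    (f : Lp ℂ 2 (cosetMeasure μ K))
    (hf : ∀ g : G, leftTranslation G (cosetMeasure μ K) g f = f) : kernelOp hM f = 0 := by
  -- The image of an invariant vector is invariant, hence equal to its own mean; only that mean has
  -- to be computed.
  have hTf := ae_eq_const_of_leftTranslation_eq (kernelOp hM f) fun g => by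
    rw [leftTranslation_kernelOp hM hinv, hf]
  set c := ∫ x, f x ∂(cosetMeasure μ K)
  have hint : ∫ x, kernelOp hM f x ∂(cosetMeasure μ K) = 0 := by
    rw [integral_congr_ae (coeFn_kernelOp hM f),
      kernelApply_congr_ae (ae_eq_const_of_leftTranslation_eq f hf)]
    have : kernelApply (cosetMeasure μ K) M (fun _ => c)
        = fun x => kernelApply (cosetMeasure μ K) M (fun _ => 1) x * c := by
      ext x
      simp [kernelApply, integral_mul_const]
    rw [this, integral_mul_const, integral_kernelApply_one hM, hmean, zero_mul]
  rw [hint] at hTf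
  exact Lp.ext (hTf.trans (Lp.coeFn_zero _ _ _).symm)

/-- Spectral gap: an invariant self-adjoint kernel with mean zero and Hilbert–Schmidt norm at most
one acts with norm at most the inverse square root of the smallest degree. -/
lemma enorm_kernelOp_le (hM : MemLp M 2 ((cosetMeasure μ K).prod (cosetMeasure μ K)))
    (hnorm : eLpNorm M 2 ((cosetMeasure μ K).prod (cosetMeasure μ K)) ≤ 1)
    (hself : IsSelfAdjointKernel (cosetMeasure μ K) M)
    (hinv : IsInvariantKernel G (cosetMeasure μ K) M)
    (hmean : ∫ z, M z ∂((cosetMeasure μ K).prod (cosetMeasure μ K)) = 0) :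
    ‖kernelOp hM‖ₑ ≤
      1 / (minNontrivialDegree (leftTranslation G (cosetMeasure μ K)) : ℝ≥0∞) ^ (1 / 2 : ℝ) := by
  by_cases h0 : kernelOp hM = 0
  · rw [← ofReal_norm, h0, norm_zero, ENNReal.ofReal_zero]
    exact zero_le
  obtain ⟨c, hc, heig⟩ := exists_hasEigenvalue_norm_eq (isCompactOperator_kernelOp hM)
    (isSymmetric_kernelOp hM hself) h0
  have hc0 : c ≠ 0 := by
    rw [← norm_ne_zero_iff, hc]
    exact norm_ne_zero_iff.2 h0
  let E : Subrepresentation (leftTranslation G (cosetMeasure μ K)) :=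
    { toSubmodule := Module.End.eigenspace (kernelOp hM : Module.End ℂ (Lp ℂ 2 (cosetMeasure μ K))) c
      apply_mem_toSubmodule := fun g v hv => by
        rw [Module.End.mem_eigenspace_iff] at hv ⊢
        simp only [ContinuousLinearMap.coe_coe] at hv ⊢
        rw [← leftTranslation_kernelOp hM hinv, hv, map_smul] }
  have hfin : FiniteDimensional ℂ E.toSubmodule :=
    (kernelOp hM).finite_dimensional_eigenspace (isCompactOperator_kernelOp hM) c hc0
  have hmem {v : Lp ℂ 2 (cosetMeasure μ K)} (hv : v ∈ E.toSubmodule) :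
      kernelOp hM v = c • v := Module.End.mem_eigenspace_iff.1 hv
  obtain ⟨U, hUE, hirr, hU⟩ := E.exists_isIrreducible_le heig fun v hv hvG => by
    have h := hmem hv
    rw [kernelOp_eq_zero_of_leftTranslation_eq hM hinv hmean v hvG] at h
    exact (smul_eq_zero.1 h.symm).resolve_left hc0
  have hUfin : FiniteDimensional ℂ U.toSubmodule := Submodule.finiteDimensional_of_le hUE
  have hdeg := minNontrivialDegree_le U hirr hU
  set n := Module.finrank ℂ U.toSubmodule
  have hsum := sum_norm_kernelOp_sq_le hM
    ((stdOrthonormalBasis ℂ U.toSubmodule).orthonormal.comp_linearIsometry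
      U.toSubmodule.subtypeₗᵢ) Finset.univ
  have hterm (i : Fin n) : ‖kernelOp hM ((U.toSubmodule.subtypeₗᵢ ∘
      stdOrthonormalBasis ℂ U.toSubmodule) i)‖ = ‖kernelOp hM‖ := by
    change ‖kernelOp hM (stdOrthonormalBasis ℂ U.toSubmodule i)‖ = _
    rw [hmem (hUE (stdOrthonormalBasis ℂ U.toSubmodule i).2), norm_smul, hc, Submodule.norm_coe,
      (stdOrthonormalBasis ℂ U.toSubmodule).norm_eq_one, mul_one]
  simp only [hterm, Finset.sum_const, Finset.card_univ, Fintype.card_fin, nsmul_eq_mul] at hsum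
  have hn : (n : ℝ) * ‖kernelOp hM‖ ^ 2 ≤ 1 :=
    hsum.trans (pow_le_one₀ ENNReal.toReal_nonneg
      (ENNReal.toReal_le_of_le_ofReal zero_le_one (by simpa using hnorm)))
  have hn' : ‖kernelOp hM‖ * √n ≤ 1 := by
    rw [← sq_le_one_iff₀ (by positivity), mul_pow, Real.sq_sqrt n.cast_nonneg, mul_comm]
    exact hn
  -- The numerator 1 is neither `0` nor `∞`, so this is valid for every value of the degree.
  rw [ENNReal.le_div_iff_mul_le (by simp) (by simp)]
  calc _ ≤ ‖kernelOp hM‖ₑ * (n : ℝ≥0∞) ^ (1 / 2 : ℝ) := by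
        gcongr
        simpa using ENat.toENNReal_le.2 hdeg
    _ = ENNReal.ofReal (‖kernelOp hM‖ * √n) := by
        rw [ENNReal.ofReal_mul (norm_nonneg _), ofReal_norm, Real.sqrt_eq_rpow,
          ← ENNReal.ofReal_rpow_of_nonneg n.cast_nonneg (by norm_num), ENNReal.ofReal_natCast]
    _ ≤ 1 := ENNReal.ofReal_le_one.2 hn'

end HomogeneousSpace

theorem mainTheorem10 {G : Type*} [Group G] [TopologicalSpace G] [IsTopologicalGroup G]
    [CompactSpace G] [T2Space G] [MeasurableSpace G] [BorelSpace G]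
    (μ : Measure G) [μ.IsHaarMeasure] [μ.Regular] [IsProbabilityMeasure μ]
    (K : Subgroup G) (hK : IsClosed (K : Set G))
    [MeasurableSpace (G ⧸ K)] [BorelSpace (G ⧸ K)]
    (H : (G ⧸ K) × (G ⧸ K) → ℂ)
    (hH : MemLp H 2 ((cosetMeasure μ K).prod (cosetMeasure μ K)))
    (hnorm : eLpNorm H 2 ((cosetMeasure μ K).prod (cosetMeasure μ K)) ≤ 1)
    (hself : IsSelfAdjointKernel (cosetMeasure μ K) H)
    (hinv : IsInvariantKernel G (cosetMeasure μ K) H) :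
    cutNorm (cosetMeasure μ K)
        (fun z => H z - ∫ w, H w ∂((cosetMeasure μ K).prod (cosetMeasure μ K))) ≤
      1 / (minNontrivialDegree (leftTranslation G (cosetMeasure μ K)) : ℝ≥0∞) ^ (1 / 2 : ℝ) := by
  set p := ∫ w, H w ∂((cosetMeasure μ K).prod (cosetMeasure μ K)) with hp
  have hM : MemLp (fun z => H z - p) 2 ((cosetMeasure μ K).prod (cosetMeasure μ K)) :=
    hH.sub (memLp_const p)
  -- Self-adjointness makes the mean real, so subtracting it keeps the kernel self-adjoint.
  have hpreal : conj p = p := by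
    rw [hp, ← integral_conj, ← integral_prod_swap]
    exact (integral_congr_ae hself).symm
  refine (cutNorm_le_enorm_kernelOp hM).trans
    (enorm_kernelOp_le hM ((eLpNorm_sub_integral_le hH).trans hnorm) ?_ ?_ ?_)
  · filter_upwards [hself] with z hz
    rw [hz, map_sub, hpreal]
  · intro g
    filter_upwards [hinv g] with z hz
    rw [hz]
  · rw [integral_sub (hH.integrable one_le_two) (integrable_const p)]
    simp [hp]
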